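/- Theorem. Let $k$ be a field, $e\ge 3$, $Q=k[[x_1,\dots,x_e]]$ with maximal ideal $\mathfrak q$. For an artinian quotient $A=Q/J$ with maximal ideal $\mathfrak m=\mathfrak q/J$ let $h_A(i)=\dim_k \mathfrak m^i/\mathfrak m^{i+1}$ be its Hilbert function, $\operatorname{Soc}A=(0:_A\mathfrak m)$ its socle, $\dim_k\operatorname{Soc}A$ its type, and call $A$ Gorenstein if its type is $1$. Its socle degree is the integer $s$ with $\mathfrak m^s\neq 0=\mathfrak m^{s+1}$, its socle polynomial is $\sum_{i=0}^{s} c_i\chi^i$ with $c_i=\dim_k\big((\mathfrak m^i\cap\operatorname{Soc}A)/(\mathfrak m^{i+1}\cap\operatorname{Soc}A)\big)$, and the initial degree of $J \ne 0$ is the integer $t$ with $J\subseteq\mathfrak q^t$, $J\not\subseteq\mathfrak q^{t+1}$. Put $h_Q(i)=\dim_k\mathfrak q^i/\mathfrak q^{i+1}=\binom{e-1+i}{e-1}$ for $i\ge0$ and $h_Q(i)=0$ for $i<0$. The ring $A$ is called compressed if $h_A(i)=\min\{h_Q(i),\sum_j c_j h_Q(j-i)\}$ for all $i\ge 0$; for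 $A$ Gorenstein this says $h_A(i)=\min\{h_Q(i),h_Q(s-i)\}$, and for $A$ of type $2$ with socle polynomial $\chi^b+\chi^s$ it says $h_A(i)=\min\{h_Q(i),h_Q(b-i)+h_Q(s-i)\}$. Let $I_1,I_2\subseteq\mathfrak q^2$ be homogeneous $\mathfrak q$-primary ideals such that $R_1=Q/I_1$ and $R_2=Q/I_2$ are compressed Gorenstein rings, and assume that $R=Q/I$ with $I=I_1\cap I_2$ has type $2$. Let $t_1,t_2,t$ be the initial degrees of $I_1,I_2,I$ and $s_1,s_2,s$ the socle degrees of $R_1,R_2,R$; assume $s_1\le s_2$ and set $a=\min\{i\ge0 : \mathfrak q^iI_2\subseteq I_1\}$. Then the length of $R$ satisfies $$\ell(R)\le\sum_{i=0}^{s}\min\{h_Q(i),\,h_{R_1}(i)+h_{R_2}(i)\},$$ and equality holds if and only if $R$ is compressed. Moreover, if $R$ is compressed, then $$2\le t_1\le t_2\le t\le s_1\le s<2s_1$$ and the following hold. (a) $h_R(i)=\min\{h_Q(i),h_{R_1}(i)+h_{R_2}(i)\}$ for all $i\ge0$. (b) $t=\min\{i : h_Q(i)>h_{R_1}(i)+h_{R_2}(i)\}$.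 (b') If $h_Q(i)=h_{R_1}(i)+h_{R_2}(i)$ for some $i \ge 0$, then $t=i+1$. (c) The socle polynomial of $R$ is $\chi^{s_1}+\chi^{s}$. (d) $a=s_1-t_2+1$. -/

import Mathlib

open Polynomial

namespace CompressedRings

noncomputable section

/-! Numerical invariants of a local `k`-algebra `R` with maximal ideal `m` whose residue field
`R/m` is `k`.  The rank over the residue field of a module killed by `m` is then its rank
over `k`. -/

section Invariants

variable (k : Type*) {R : Type*} [Field k] [CommRing R] [Algebra k R]

/-- The Hilbert function `i ↦ rank_k (m^i / m^(i+1))`. -/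
def hilbertFunction (m : Ideal R) (i : ℕ) : ℕ :=
  Module.finrank k (↥(m ^ i) ⧸ Submodule.submoduleOf (m ^ (i + 1)) (m ^ i))

/-- The socle `(0 :_R m)`. -/
def socle (m : Ideal R) : Ideal R := Submodule.annihilator m

/-- The type of `R`, the rank of its socle. -/
def type (m : Ideal R) : ℕ := Module.finrank k ↥(socle m)

/-- The socle degree: the integer `s` with `m^s ≠ 0 = m^(s+1)`. -/
def socleDegree (m : Ideal R) : ℕ := sInf {n : ℕ | m ^ (n + 1) = ⊥}

/-- The rank of `(m^i ∩ Soc R) / (m^(i+1) ∩ Soc R)`. -/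
def socleRank (m : Ideal R) (i : ℕ) : ℕ :=
  Module.finrank k (↥(m ^ i ⊓ socle m) ⧸
    Submodule.submoduleOf (m ^ (i + 1) ⊓ socle m) (m ^ i ⊓ socle m))

/-- The socle polynomial `∑_{i=0}^s rank ((m^i ∩ Soc R) / (m^(i+1) ∩ Soc R)) χ^i`. -/
def soclePolynomial (m : Ideal R) : ℕ[X] :=
  ∑ i ∈ Finset.range (socleDegree m + 1), monomial i (socleRank k m i)

end Invariants

section PowerSeries

variable {k : Type*} [Field k] {e : ℕ}

/-- The maximal ideal of the power series ring in `e` variables over `k`. -/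
def maxIdeal (k : Type*) [Field k] (e : ℕ) : Ideal (MvPowerSeries (Fin e) k) :=
  IsLocalRing.maximalIdeal (MvPowerSeries (Fin e) k)

/-- The ideal `m = q/I` of `Q/I`, where `q` is the maximal ideal of the power series ring `Q`. -/
def quotMax (I : Ideal (MvPowerSeries (Fin e) k)) : Ideal (MvPowerSeries (Fin e) k ⧸ I) :=
  (maxIdeal k e).map (Ideal.Quotient.mk I)

/-- An ideal of the power series ring is homogeneous if it is generated by homogeneous forms. -/
def IsHomogeneousIdeal (I : Ideal (MvPowerSeries (Fin e) k)) : Prop :=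
  ∃ S : Set (MvPowerSeries (Fin e) k),
    (∀ f ∈ S, ∃ n : ℕ, MvPowerSeries.IsHomogeneous f n) ∧ I = Ideal.span S

/-- `I` is primary to the maximal ideal. -/
def IsMaxPrimary (I : Ideal (MvPowerSeries (Fin e) k)) : Prop :=
  I.IsPrimary ∧ I.radical = maxIdeal k e

/-- The initial degree of `I`: the integer `t` with `I ⊆ q^t` and `I ⊄ q^(t+1)`. -/
def initialDegree (I : Ideal (MvPowerSeries (Fin e) k)) : ℕ :=
  sInf {n : ℕ | ¬ I ≤ maxIdeal k e ^ (n + 1)}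

/-- The Hilbert function of the power series ring. -/
def hQ (k : Type*) [Field k] (e i : ℕ) : ℕ := hilbertFunction k (maxIdeal k e) i

/-- The Hilbert function of `Q/I`. -/
def hQuot (I : Ideal (MvPowerSeries (Fin e) k)) (i : ℕ) : ℕ := hilbertFunction k (quotMax I) i

/-- The artinian ring `Q/I` (`I` primary to the maximal ideal) is Gorenstein: it has type `1`. -/
def IsGorensteinQuot (I : Ideal (MvPowerSeries (Fin e) k)) : Prop := type k (quotMax I) = 1

/-- `Q/I`, with socle polynomial `∑_j c_j χ^j` and socle degree `s`, is compressed if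
`h_{Q/I}(i) = min {h_Q(i), ∑_j c_j h_Q(j - i)}` for all `i ≥ 0`, where `h_Q` vanishes at negative
integers.  For socle polynomial `χ^s` (the Gorenstein case) the second entry is `h_Q(s - i)`, for
socle polynomial `χ^b + χ^s` (type `2`) it is `h_Q(b - i) + h_Q(s - i)`. -/
def IsCompressedQuot (I : Ideal (MvPowerSeries (Fin e) k)) : Prop :=
  ∀ i : ℕ, hQuot I i = min (hQ k e i)
    (∑ j ∈ Finset.Icc i (socleDegree (quotMax I)),
      (soclePolynomial k (quotMax I)).coeff j * hQ k e (j - i))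

end PowerSeries

end

end CompressedRings

/-! Since `I₁` and `I₂` are homogeneous, all invariants can be computed degree by degree from spaces
of forms: `h_{Q/I}(i)` is the codimension of `I_i` in `Q_i`, and the socle rank in degree `i` is the
codimension of `I_i` in `(I : q)_i`. Intersecting subspaces gives `h_R ≤ min {h_Q, h_{R₁} + h_{R₂}}`
(`hQuot_inf_le_min`), and summing this gives the length bound.

Colons by `q` commute with intersections, so the socle of `R` is at most the sum of the two
one-dimensional socles, in each degree. Type 2 forces equality (`socleRank_inf_eq`): the socle
polynomial is `χ^{s₁} + χ^{s₂}` and `s = s₂`. Hence `R` is compressed exactly when the bound is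
attained in every degree (`isCompressedQuot_inf_iff`), that is, when it is attained in total.

The inequalities compare values of `h_Q`, which is strictly increasing. If `s₁ < s₂`, the socle of
`R` in degree `s₁` produces a nonzero form of that degree in `I₂`, whence `s₂ < 2s₁`
(`hQuot_lt_of_type_eq_two`). In degree `s₁` the sum `h_{R₁} + h_{R₂}` is at most `1 + h_Q(s₁ - 1)`,
which is below `h_Q(s₁)` as `h_Q` grows by at least 2 when `e ≥ 3`; so `t ≤ s₁`. For (d), `q^{s₁+1}
⊆ I₁` gives one bound. For the other, an exponent `n ≤ s₁ - t₂` would by Gorenstein duality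
(`IsGorensteinQuot.mem_of_mul_mem`) put the forms of degree `t₂` of `I₂` into `I₁`, so that `h_R(t₂)
= h_{R₂}(t₂)`, contradicting (a). -/

namespace CompressedRings

/-! ### Powers of the maximal ideal, homogeneous components and spaces of forms -/

section GradedPieces

open MvPowerSeries

variable {k : Type*} [Field k] {e : ℕ}

lemma mem_maxIdeal {f : MvPowerSeries (Fin e) k} :
    f ∈ maxIdeal k e ↔ constantCoeff f = 0 := by
  rw [maxIdeal, IsLocalRing.mem_maximalIdeal, mem_nonunits_iff, MvPowerSeries.isUnit_iff_constantCoeff,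
    isUnit_iff_ne_zero, not_not]

lemma X_mem_maxIdeal (j : Fin e) : (MvPowerSeries.X j : MvPowerSeries (Fin e) k) ∈ maxIdeal k e := by
  rw [mem_maxIdeal]; exact constantCoeff_X j

lemma coeff_X_mul_add_single (g : MvPowerSeries (Fin e) k) (j : Fin e) (d : Fin e →₀ ℕ) :
    MvPowerSeries.coeff (Finsupp.single j 1 + d) (MvPowerSeries.X j * g) = MvPowerSeries.coeff d g := by
  rw [MvPowerSeries.X, coeff_add_monomial_mul, one_mul]

lemma coeff_X_mul_of_eq_zero (g : MvPowerSeries (Fin e) k) {j : Fin e} {d : Fin e →₀ ℕ}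
    (h : d j = 0) : MvPowerSeries.coeff d (MvPowerSeries.X j * g) = 0 := by
  classical
  rw [MvPowerSeries.X, MvPowerSeries.coeff_monomial_mul, if_neg]
  intro hle
  have := hle j
  simp [h] at this

/-- A power series of positive order is a combination of the variables, with coefficients of
order one less. -/
lemma exists_eq_sum_X_mul {n : ℕ} {f : MvPowerSeries (Fin e) k}
    (hf : ∀ d, d.degree < n + 1 → MvPowerSeries.coeff d f = 0) :
    ∃ g : Fin e → MvPowerSeries (Fin e) k, f = ∑ j, MvPowerSeries.X j * g j ∧
      ∀ j d, d.degree < n → MvPowerSeries.coeff d (g j) = 0 := by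
  classical
  have hne : ∀ d : Fin e →₀ ℕ, d ≠ 0 → d.support.Nonempty := fun d hd =>
    Finsupp.support_nonempty_iff.2 hd
  -- Each monomial is charged to the smallest variable dividing it, so that it occurs in exactly one
  -- of the products `X j * G j`.
  let v : (d : Fin e →₀ ℕ) → d ≠ 0 → Fin e := fun d hd => d.support.min' (hne d hd)
  have hs : ∀ (j : Fin e) (d : Fin e →₀ ℕ), Finsupp.single j 1 + d ≠ 0 := by
    intro j d h
    have := DFunLike.congr_fun h j
    simp at this
  let G : Fin e → MvPowerSeries (Fin e) k := fun j d =>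
    if v (Finsupp.single j 1 + d) (hs j d) = j
      then MvPowerSeries.coeff (Finsupp.single j 1 + d) f else 0
  have hG : ∀ j d, MvPowerSeries.coeff d (G j) = if v (Finsupp.single j 1 + d) (hs j d) = j
      then MvPowerSeries.coeff (Finsupp.single j 1 + d) f else 0 := fun _ _ => rfl
  refine ⟨G, ?_, ?_⟩
  · ext d
    rw [map_sum]
    by_cases hd : d = 0
    · rw [hf d (by simp [hd]), Finset.sum_eq_zero]
      intro j _
      exact coeff_X_mul_of_eq_zero _ (by simp [hd])
    · have hv : d (v d hd) ≠ 0 := Finsupp.mem_support_iff.1 (Finset.min'_mem _ (hne d hd))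
      have key : ∀ j, d j ≠ 0 → Finsupp.single j 1 + (d - Finsupp.single j 1) = d := by
        intro j hj
        apply add_tsub_cancel_of_le
        rw [Finsupp.single_le_iff]
        exact Nat.one_le_iff_ne_zero.2 hj
      have hterm : ∀ (g : MvPowerSeries (Fin e) k) (j) (_ : d j ≠ 0),
          MvPowerSeries.coeff d (MvPowerSeries.X j * g) = MvPowerSeries.coeff (d - Finsupp.single j 1) g := by
        intro g j hj
        conv_lhs => rw [← key j hj]
        exact coeff_X_mul_add_single _ _ _
      have hvc : ∀ j, d j ≠ 0 → ∀ h, v (Finsupp.single j 1 + (d - Finsupp.single j 1)) h = v d hd := by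
        intro j hj h
        congr 1
        · rw [key j hj]
      rw [Finset.sum_eq_single (v d hd)]
      · rw [hterm _ _ hv, hG, if_pos (hvc _ hv (hs _ _)), key _ hv]
      · intro j _ hj
        by_cases hdj : d j = 0
        · exact coeff_X_mul_of_eq_zero _ hdj
        · rw [hterm _ _ hdj, hG, if_neg]
          rw [hvc _ hdj (hs _ _)]
          exact fun h => hj h.symm
      · simp
  · intro j d hd
    rw [hG]
    split_ifs
    · apply hf
      simp
      omega
    · rfl

lemma mem_maxIdeal_pow {n : ℕ} {f : MvPowerSeries (Fin e) k} :
    f ∈ maxIdeal k e ^ n ↔ ∀ d : Fin e →₀ ℕ, d.degree < n → MvPowerSeries.coeff d f = 0 := by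
  constructor
  · intro h d hd
    suffices H : (n : ℕ∞) ≤ f.order from
      coeff_of_lt_order (lt_of_lt_of_le (by exact_mod_cast hd) H)
    clear hd d
    induction n generalizing f with
    | zero => simp
    | succ n ih =>
      rw [pow_succ] at h
      refine Submodule.mul_induction_on h ?_ ?_
      · intro a ha b hb
        refine le_trans ?_ le_order_mul
        push_cast
        exact add_le_add (ih ha) (one_le_order_iff_constCoeff_eq_zero.2 (mem_maxIdeal.1 hb))
      · intro a b ha hb
        exact le_trans (le_min ha hb) min_order_le_add
  · induction n generalizing f with
    | zero => simp
    | succ n ih =>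
      intro h
      obtain ⟨g, rfl, hg⟩ := exists_eq_sum_X_mul h
      refine Ideal.sum_mem _ fun j _ => ?_
      rw [pow_succ']
      exact Ideal.mul_mem_mul (X_mem_maxIdeal j) (ih (hg j))

lemma IsHomogeneous.mem_maxIdeal_pow {n : ℕ} {f : MvPowerSeries (Fin e) k} (hf : f.IsHomogeneous n) :
    f ∈ maxIdeal k e ^ n :=
  CompressedRings.mem_maxIdeal_pow.2 fun _ hd => hf.coeff_eq_zero hd.ne

lemma homogeneousComponent_of_mem_pow {n i : ℕ} (hi : i < n) {f : MvPowerSeries (Fin e) k}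
    (hf : f ∈ maxIdeal k e ^ n) : homogeneousComponent i f = 0 := by
  ext d
  rw [coeff_homogeneousComponent]
  split_ifs with h
  · rw [mem_maxIdeal_pow.1 hf d (by omega), map_zero]
  · simp

lemma homogeneousComponent_eq_self {n : ℕ} {f : MvPowerSeries (Fin e) k} (hf : f.IsHomogeneous n) :
    homogeneousComponent n f = f :=
  ((isHomogeneous_iff_eq_homogeneousComponent).1 hf).symm

lemma homogeneousComponent_of_ne {n i : ℕ} {f : MvPowerSeries (Fin e) k} (hf : f.IsHomogeneous n)
    (h : i ≠ n) : homogeneousComponent i f = 0 := by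
  ext d
  rw [coeff_homogeneousComponent]
  split_ifs with h'
  · rw [hf.coeff_eq_zero (by omega), map_zero]
  · simp

lemma sub_homogeneousComponent_mem {n : ℕ} {f : MvPowerSeries (Fin e) k}
    (hf : f ∈ maxIdeal k e ^ n) : f - homogeneousComponent n f ∈ maxIdeal k e ^ (n + 1) := by
  rw [mem_maxIdeal_pow] at hf ⊢
  intro d hd
  rw [map_sub, coeff_homogeneousComponent]
  split_ifs with h
  · simp
  · rw [hf d (by omega), sub_zero]

lemma sub_sum_homogeneousComponent_mem (n : ℕ) (f : MvPowerSeries (Fin e) k) :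
    f - ∑ i ∈ Finset.range n, homogeneousComponent i f ∈ maxIdeal k e ^ n := by
  rw [mem_maxIdeal_pow]
  intro d hd
  rw [map_sub, map_sum, sub_eq_zero]
  simp [coeff_homogeneousComponent, hd]

lemma homogeneousComponent_mul {n : ℕ} (m : ℕ) (a : MvPowerSeries (Fin e) k)
    {f : MvPowerSeries (Fin e) k} (hf : f.IsHomogeneous n) :
    homogeneousComponent (m + n) (a * f) = homogeneousComponent m a * f := by
  classical
  ext d
  rw [coeff_homogeneousComponent]
  split_ifs with h
  · rw [MvPowerSeries.coeff_mul, MvPowerSeries.coeff_mul]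
    refine Finset.sum_congr rfl fun x hx => ?_
    rw [Finset.HasAntidiagonal.mem_antidiagonal] at hx
    by_cases hn : x.2.degree = n
    · rw [coeff_homogeneousComponent, if_pos]
      have := congrArg Finsupp.degree hx
      rw [map_add] at this
      omega
    · rw [hf.coeff_eq_zero hn]; simp
  · exact (MvPowerSeries.IsHomogeneous.coeff_eq_zero (MvPowerSeries.IsHomogeneous.mul
      (isHomogeneous_homogeneousComponent a m) hf) h).symm

lemma homogeneousComponent_mul_of_lt {n i : ℕ} (hi : i < n) (a : MvPowerSeries (Fin e) k)
    {f : MvPowerSeries (Fin e) k} (hf : f.IsHomogeneous n) :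
    homogeneousComponent i (a * f) = 0 :=
  homogeneousComponent_of_mem_pow hi (Ideal.mul_mem_left _ _ (IsHomogeneous.mem_maxIdeal_pow hf))

/-- An ideal is graded if it contains the homogeneous components of its elements. -/
def IsGraded (I : Ideal (MvPowerSeries (Fin e) k)) : Prop :=
  ∀ f ∈ I, ∀ i, homogeneousComponent i f ∈ I

lemma IsHomogeneousIdeal.isGraded {I : Ideal (MvPowerSeries (Fin e) k)}
    (hI : IsHomogeneousIdeal I) : IsGraded I := by
  obtain ⟨S, hS, rfl⟩ := hI
  intro f hf i
  induction hf using Submodule.span_induction with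
  | mem f hf =>
    obtain ⟨n, hn⟩ := hS f hf
    by_cases h : i = n
    · subst h
      rw [homogeneousComponent_eq_self hn]
      exact Ideal.subset_span hf
    · rw [homogeneousComponent_of_ne hn h]
      exact zero_mem _
  | zero => rw [map_zero]; exact zero_mem _
  | add f g _ _ hf hg => rw [map_add]; exact add_mem hf hg
  | smul a f hfS hf =>
    -- Components of `f` in the ideal do not directly control those of `a * f`; a second induction,
    -- with the multiplier arbitrary, replaces the hypothesis.
    clear hf
    rw [smul_eq_mul]
    induction hfS using Submodule.span_induction generalizing a with
    | mem f hf =>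
      obtain ⟨n, hn⟩ := hS f hf
      by_cases h : i < n
      · rw [homogeneousComponent_mul_of_lt h _ hn]; exact zero_mem _
      · obtain ⟨m, rfl⟩ := Nat.exists_eq_add_of_le' (not_lt.1 h)
        rw [homogeneousComponent_mul m a hn]
        exact Ideal.mul_mem_left _ _ (Ideal.subset_span hf)
    | zero => rw [mul_zero, map_zero]; exact zero_mem _
    | add f g _ _ hf hg => rw [mul_add, map_add]; exact add_mem (hf a) (hg a)
    | smul b f _ hf => rw [smul_eq_mul, ← mul_assoc]; exact hf (a * b)

lemma IsGraded.inf {I J : Ideal (MvPowerSeries (Fin e) k)} (hI : IsGraded I) (hJ : IsGraded J) :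
    IsGraded (I ⊓ J) := fun f hf i => ⟨hI f hf.1 i, hJ f hf.2 i⟩

/-- The homogeneous forms of degree `i` in an ideal. -/
def gradedPiece (I : Ideal (MvPowerSeries (Fin e) k)) (i : ℕ) :
    Submodule k (MvPowerSeries (Fin e) k) where
  carrier := {f | f ∈ I ∧ f.IsHomogeneous i}
  add_mem' ha hb := ⟨add_mem ha.1 hb.1, MvPowerSeries.IsHomogeneous.add ha.2 hb.2⟩
  zero_mem' := ⟨zero_mem _, fun h => absurd (map_zero _) h⟩
  smul_mem' c f hf := ⟨by
    rw [Algebra.smul_def]; exact Ideal.mul_mem_left _ _ hf.1, by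
    intro d hd
    apply hf.2
    intro h
    apply hd
    rw [map_smul, h, smul_zero]⟩

lemma mem_gradedPiece {I : Ideal (MvPowerSeries (Fin e) k)} {i : ℕ}
    {f : MvPowerSeries (Fin e) k} : f ∈ gradedPiece I i ↔ f ∈ I ∧ f.IsHomogeneous i := Iff.rfl

lemma gradedPiece_mono {I J : Ideal (MvPowerSeries (Fin e) k)} (h : I ≤ J) (i : ℕ) :
    gradedPiece I i ≤ gradedPiece J i := fun _ hf => ⟨h hf.1, hf.2⟩

lemma gradedPiece_inf (I J : Ideal (MvPowerSeries (Fin e) k)) (i : ℕ) :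
    gradedPiece (I ⊓ J) i = gradedPiece I i ⊓ gradedPiece J i := by
  ext f
  simp only [mem_gradedPiece, Submodule.mem_inf]
  tauto

lemma gradedPiece_bot (i : ℕ) : gradedPiece (⊥ : Ideal (MvPowerSeries (Fin e) k)) i = ⊥ := by
  rw [eq_bot_iff]
  exact fun f hf => hf.1

/-- Homogeneous forms of degree `i` are given by their coefficients. -/
noncomputable def formsEquiv (k : Type*) [Field k] (e i : ℕ) :
    gradedPiece (⊤ : Ideal (MvPowerSeries (Fin e) k)) i ≃ₗ[k]
      ((Finset.univ : Finset (Fin e)).finsuppAntidiag i → k) :=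
  LinearEquiv.ofBijective
    (LinearMap.pi fun d => (MvPowerSeries.coeff d.1).comp (Submodule.subtype _)) <| by
    classical
    have hdeg : ∀ d : Fin e →₀ ℕ, d ∈ (Finset.univ : Finset (Fin e)).finsuppAntidiag i ↔
        d.degree = i := by
      intro d
      rw [Finset.mem_finsuppAntidiag, Finsupp.degree_eq_sum]
      simp
    constructor
    · rw [← LinearMap.ker_eq_bot, eq_bot_iff]
      rintro ⟨f, hf⟩ h
      rw [LinearMap.mem_ker] at h
      rw [Submodule.mem_bot, Submodule.mk_eq_zero]
      ext d
      by_cases hd : d.degree = i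
      · exact congrFun h ⟨d, (hdeg d).2 hd⟩
      · exact MvPowerSeries.IsHomogeneous.coeff_eq_zero hf.2 hd
    · intro c
      let f : MvPowerSeries (Fin e) k := fun d =>
        if h : d ∈ (Finset.univ : Finset (Fin e)).finsuppAntidiag i then c ⟨d, h⟩ else 0
      have hc : ∀ d, MvPowerSeries.coeff d f = if h : d ∈ (Finset.univ : Finset (Fin e)).finsuppAntidiag i
        then c ⟨d, h⟩ else 0 := fun d => rfl
      refine ⟨⟨f, trivial, ?_⟩, ?_⟩
      · intro d hd
        rw [hc] at hd
        have : d ∈ (Finset.univ : Finset (Fin e)).finsuppAntidiag i := by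
          by_contra h
          rw [dif_neg h] at hd
          exact hd rfl
        rw [hdeg] at this
        rw [← this, Finsupp.degree_eq_weight_one]
        rfl
      · ext d
        change MvPowerSeries.coeff d.1 f = c d
        rw [hc, dif_pos d.2]

instance finiteDimensional_gradedPiece (I : Ideal (MvPowerSeries (Fin e) k)) (i : ℕ) :
    FiniteDimensional k (gradedPiece I i) := by
  have : FiniteDimensional k (gradedPiece (⊤ : Ideal (MvPowerSeries (Fin e) k)) i) :=
    (formsEquiv k e i).symm.finiteDimensional
  exact Submodule.finiteDimensional_of_le (gradedPiece_mono le_top i)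

/-- The number of monomials of degree `i` in `e` variables. -/
def formsRank (e i : ℕ) : ℕ := ((Finset.univ : Finset (Fin e)).finsuppAntidiag i).card

lemma finrank_gradedPiece_top (i : ℕ) :
    Module.finrank k (gradedPiece (⊤ : Ideal (MvPowerSeries (Fin e) k)) i) = formsRank e i := by
  rw [(formsEquiv k e i).finrank_eq, Module.finrank_fintype_fun_eq_card, Fintype.card_coe,
    formsRank]

lemma formsRank_zero (e : ℕ) : formsRank e 0 = 1 := by
  simp [formsRank]

/-- By Pascal's rule applied twice, the increment is a sum of two positive multichoose numbers. For
`e = 2` it would be only 1. -/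
lemma formsRank_add_two_le (he : 3 ≤ e) (i : ℕ) : formsRank e i + 2 ≤ formsRank e (i + 1) := by
  obtain ⟨m, rfl⟩ := Nat.exists_eq_add_of_le' he
  rw [formsRank, formsRank, Finset.card_finsuppAntidiag_nat_eq_multichoose,
    Finset.card_finsuppAntidiag_nat_eq_multichoose, Finset.card_univ, Fintype.card_fin,
    Nat.multichoose_succ_succ, Nat.multichoose_succ_succ]
  have hpos : ∀ n j, 0 < Nat.multichoose (n + 1) j := fun n j => by
    rw [Nat.multichoose_eq]
    exact Nat.choose_pos (by omega)
  have h1 := hpos m (i + 1)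
  have h2 := hpos (m + 1) i
  have h3 : (m + 3).multichoose i = (m + 2 + 1).multichoose i := rfl
  omega

end GradedPieces

/-! ### Lengths and ranks along filtrations -/

section Filtrations

variable {k R : Type*} [Field k] [CommRing R] [Algebra k R]

lemma finrank_eq_add_finrank_quotient {A B : Ideal R} [FiniteDimensional k R] (h : B ≤ A) :
    Module.finrank k A = Module.finrank k (A ⧸ Submodule.submoduleOf B A) +
      Module.finrank k B := by
  have : FiniteDimensional k A := FiniteDimensional.finiteDimensional_submodule (A.restrictScalars k)
  rw [← Submodule.finrank_quotient_add_finrank ((Submodule.submoduleOf B A).restrictScalars k)]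
  congr 1
  exact ((Submodule.submoduleOfEquivOfLe h).restrictScalars k).finrank_eq

lemma finrank_eq_sum_finrank_quotient [FiniteDimensional k R] {F : ℕ → Ideal R} (hF : Antitone F)
    {n : ℕ} (hn : F n = ⊥) :
    Module.finrank k (F 0) = ∑ i ∈ Finset.range n,
      Module.finrank k (F i ⧸ Submodule.submoduleOf (F (i + 1)) (F i)) := by
  have H : ∀ n, Module.finrank k (F 0) = ∑ i ∈ Finset.range n,
      Module.finrank k (F i ⧸ Submodule.submoduleOf (F (i + 1)) (F i)) +
        Module.finrank k (F n) := by
    intro n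
    induction n with
    | zero => simp
    | succ n ih =>
      rw [ih, finrank_eq_add_finrank_quotient (k := k) (hF n.le_succ), Finset.sum_range_succ,
        add_assoc]
  have h0 : Module.finrank k (F n) = 0 := by
    rw [hn]
    exact Module.finrank_zero_of_subsingleton
  rw [H n, h0, add_zero]

/-- On a module killed by `m`, the ring acts through constants of `k`, so the `R`-submodules are the
`k`-subspaces. -/
lemma length_eq_finrank {m : Ideal R} (hm : ∀ r : R, ∃ c : k, r - algebraMap k R c ∈ m)
    (M : Type*) [AddCommGroup M] [Module R M] [Module k M] [IsScalarTower k R M]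
    [FiniteDimensional k M] (hM : ∀ r ∈ m, ∀ x : M, r • x = 0) :
    Module.length R M = Module.finrank k M := by
  rw [← Module.length_eq_finrank]
  have hsmul : ∀ (r : R), ∃ c : k, ∀ x : M, r • x = c • x := by
    intro r
    obtain ⟨c, hc⟩ := hm r
    refine ⟨c, fun x => ?_⟩
    have := hM _ hc x
    rwa [sub_smul, sub_eq_zero, algebraMap_smul] at this
  let ψ : Submodule R M ≃o Submodule k M :=
    { toFun := fun N => N.restrictScalars k
      invFun := fun N =>
        { N with
          smul_mem' := fun r x hx => by
            obtain ⟨c, hc⟩ := hsmul r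
            rw [hc]
            exact N.smul_mem c hx }
      left_inv := fun N => rfl
      right_inv := fun N => rfl
      map_rel_iff' := Iff.rfl }
  rw [Module.length_eq_height, Module.length_eq_height, ← Order.height_orderIso ψ]
  congr 1

lemma length_eq_add_length_quotient {A B : Ideal R} (h : B ≤ A) :
    Module.length R A = Module.length R B +
      Module.length R (A ⧸ Submodule.submoduleOf B A) := by
  rw [← (Submodule.submoduleOfEquivOfLe h).length_eq]
  exact Module.length_eq_add_of_exact (Submodule.submoduleOf B A).subtype
    (Submodule.submoduleOf B A).mkQ (Submodule.subtype_injective _)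
    (Submodule.mkQ_surjective _) (LinearMap.exact_subtype_mkQ _)

lemma finiteDimensional_quotient_submoduleOf [FiniteDimensional k R] (A B : Ideal R) :
    FiniteDimensional k (A ⧸ Submodule.submoduleOf B A) := by
  have : Module.Finite k A :=
    FiniteDimensional.finiteDimensional_submodule (A.restrictScalars k)
  exact Module.Finite.quotient k _

lemma smul_quotient_eq_zero {m A B : Ideal R} (h : m * A ≤ B) (r : R) (hr : r ∈ m)
    (x : A ⧸ Submodule.submoduleOf B A) : r • x = 0 := by
  obtain ⟨x, rfl⟩ := Submodule.Quotient.mk_surjective _ x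
  rw [← Submodule.Quotient.mk_smul, Submodule.Quotient.mk_eq_zero]
  exact h (Ideal.mul_mem_mul hr x.2)

lemma length_quotient_eq_finrank [FiniteDimensional k R] {m : Ideal R}
    (hm : ∀ r : R, ∃ c : k, r - algebraMap k R c ∈ m) {A B : Ideal R} (h : m * A ≤ B) :
    Module.length R (A ⧸ Submodule.submoduleOf B A) =
      Module.finrank k (A ⧸ Submodule.submoduleOf B A) := by
  have := finiteDimensional_quotient_submoduleOf (k := k) A B
  exact length_eq_finrank hm (A ⧸ Submodule.submoduleOf B A) (smul_quotient_eq_zero h)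

lemma length_eq_sum_hilbertFunction [FiniteDimensional k R] {m : Ideal R}
    (hm : ∀ r : R, ∃ c : k, r - algebraMap k R c ∈ m) {n : ℕ} (hn : m ^ n = ⊥) :
    Module.length R R = ((∑ i ∈ Finset.range n, hilbertFunction k m i : ℕ) : ℕ∞) := by
  have H : ∀ n, Module.length R R = ((∑ i ∈ Finset.range n, hilbertFunction k m i : ℕ) : ℕ∞) +
      Module.length R ↥(m ^ n) := by
    intro n
    induction n with
    | zero =>
      have : m ^ 0 = ⊤ := by simp
      rw [this, Submodule.topEquiv.length_eq]
      simp
    | succ n ih =>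
      rw [ih, length_eq_add_length_quotient (Ideal.pow_le_pow_right n.le_succ),
        length_quotient_eq_finrank (k := k) hm (pow_succ' m n).ge, Finset.sum_range_succ,
        hilbertFunction]
      push_cast
      ring
  have h0 : Module.length R ↥(m ^ n) = 0 := by
    rw [hn]
    exact Module.length_bot
  rw [H n, h0, add_zero]

lemma finrank_socle_eq_sum_socleRank [FiniteDimensional k R] {m : Ideal R} {n : ℕ}
    (hn : m ^ n = ⊥) : type k m = ∑ i ∈ Finset.range n, socleRank k m i := by
  have := finrank_eq_sum_finrank_quotient (k := k) (F := fun i => m ^ i ⊓ socle m)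
    (fun i j h => inf_le_inf_right _ (Ideal.pow_le_pow_right h)) (n := n) (by simp [hn])
  have h0 : m ^ 0 ⊓ socle m = socle m := by simp
  change Module.finrank k ↥(m ^ 0 ⊓ socle m) = _ at this
  rw [h0] at this
  exact this

end Filtrations

/-! ### Hilbert function and socle of a graded quotient via forms -/

section Quotients

open MvPowerSeries

variable {k : Type*} [Field k] {e : ℕ}

/-- The forms of degree `i` in `J` map onto `A/B`, with kernel those in `I`. This is the common
source of the formulas for `hQ`, `hQuot` and `socleRank`, stated additively to avoid subtraction in
`ℕ`. -/
lemma finrank_quotient_add_finrank_gradedPiece {R : Type*} [CommRing R] [Algebra k R]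
    (π : MvPowerSeries (Fin e) k →ₗ[k] R) {I J : Ideal (MvPowerSeries (Fin e) k)} (hIJ : I ≤ J)
    {A B : Ideal R} {i : ℕ} (h₁ : ∀ f ∈ gradedPiece J i, π f ∈ A)
    (h₂ : ∀ a ∈ A, ∃ f ∈ gradedPiece J i, a - π f ∈ B)
    (h₃ : ∀ f ∈ gradedPiece J i, π f ∈ B ↔ f ∈ I) :
    Module.finrank k (A ⧸ Submodule.submoduleOf B A) + Module.finrank k (gradedPiece I i) =
      Module.finrank k (gradedPiece J i) := by
  let φ : gradedPiece J i →ₗ[k] (A ⧸ Submodule.submoduleOf B A) :=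
    ((Submodule.submoduleOf B A).mkQ.restrictScalars k).comp
      ((π.comp (gradedPiece J i).subtype).codRestrict (A.restrictScalars k) fun f => h₁ f.1 f.2)
  have hφ : ∀ f, φ f = Submodule.Quotient.mk ⟨π f.1, h₁ f.1 f.2⟩ := fun f => rfl
  have hsurj : Function.Surjective φ := by
    intro x
    obtain ⟨⟨a, ha⟩, rfl⟩ := Submodule.mkQ_surjective _ x
    obtain ⟨f, hf, hfa⟩ := h₂ a ha
    refine ⟨⟨f, hf⟩, ?_⟩
    rw [hφ, Submodule.mkQ_apply, eq_comm, Submodule.Quotient.eq]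
    exact hfa
  have hker : LinearMap.ker φ = (gradedPiece I i).submoduleOf (gradedPiece J i) := by
    ext ⟨f, hf⟩
    rw [LinearMap.mem_ker, hφ, Submodule.Quotient.mk_eq_zero]
    change π f ∈ B ↔ f ∈ gradedPiece I i
    rw [h₃ f hf]
    exact ⟨fun h => ⟨h, hf.2⟩, fun h => h.1⟩
  rw [← LinearMap.finrank_range_add_finrank_ker φ, LinearMap.range_eq_top.2 hsurj, finrank_top,
    hker, (Submodule.submoduleOfEquivOfLe (gradedPiece_mono hIJ i)).finrank_eq]

lemma hQ_eq (k : Type*) [Field k] (e i : ℕ) : hQ k e i = formsRank e i := by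
  have := finrank_quotient_add_finrank_gradedPiece (k := k) (e := e) LinearMap.id
    (I := ⊥) (J := ⊤) bot_le (A := maxIdeal k e ^ i) (B := maxIdeal k e ^ (i + 1)) (i := i)
    (fun f hf => IsHomogeneous.mem_maxIdeal_pow hf.2)
    (fun f hf => ⟨homogeneousComponent i f, ⟨trivial, isHomogeneous_homogeneousComponent f i⟩,
      sub_homogeneousComponent_mem hf⟩)
    (fun f hf => ⟨fun h => by
      rw [← homogeneousComponent_eq_self hf.2]
      exact homogeneousComponent_of_mem_pow i.lt_succ_self h, fun h => by
      rw [Ideal.mem_bot] at h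
      rw [h]; exact zero_mem _⟩)
  rw [gradedPiece_bot, finrank_bot, add_zero, finrank_gradedPiece_top] at this
  exact this

variable {I : Ideal (MvPowerSeries (Fin e) k)}

lemma mem_quotMax_pow {n : ℕ} {r : MvPowerSeries (Fin e) k ⧸ I} :
    r ∈ quotMax I ^ n ↔ ∃ f ∈ maxIdeal k e ^ n, Ideal.Quotient.mk I f = r := by
  rw [quotMax, ← Ideal.map_pow, Ideal.mem_map_iff_of_surjective _ Ideal.Quotient.mk_surjective]

lemma mk_mem_quotMax_pow_succ (hI : IsGraded I) {n : ℕ} {f : MvPowerSeries (Fin e) k}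
    (hf : f.IsHomogeneous n) : Ideal.Quotient.mk I f ∈ quotMax I ^ (n + 1) ↔ f ∈ I := by
  rw [mem_quotMax_pow]
  constructor
  · rintro ⟨g, hg, h⟩
    rw [Ideal.Quotient.eq] at h
    -- As `g` has order above `n`, the degree `n` component of `f - g` is `f` itself, and gradedness
    -- puts it in `I`.
    have := hI _ h n
    rw [map_sub, homogeneousComponent_eq_self hf,
      homogeneousComponent_of_mem_pow n.lt_succ_self hg, zero_sub] at this
    simpa using this
  · intro h
    exact ⟨0, zero_mem _, by rw [map_zero, Ideal.Quotient.eq_zero_iff_mem.2 h]⟩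

lemma hQuot_add_finrank (hI : IsGraded I) (i : ℕ) :
    hQuot I i + Module.finrank k (gradedPiece I i) = formsRank e i := by
  rw [← finrank_gradedPiece_top (k := k)]
  refine finrank_quotient_add_finrank_gradedPiece (Ideal.Quotient.mkₐ k I).toLinearMap le_top
    (fun f hf => mem_quotMax_pow.2 ⟨f, IsHomogeneous.mem_maxIdeal_pow hf.2, rfl⟩) ?_
    (fun f hf => mk_mem_quotMax_pow_succ hI hf.2)
  intro a ha
  obtain ⟨f, hf, rfl⟩ := mem_quotMax_pow.1 ha
  exact ⟨homogeneousComponent i f, ⟨trivial, isHomogeneous_homogeneousComponent f i⟩,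
    mem_quotMax_pow.2 ⟨_, sub_homogeneousComponent_mem hf, map_sub _ _ _⟩⟩

/-- The colon ideal `(I : q)`, the preimage of the socle of `Q/I`. -/
noncomputable def socleIdeal (I : Ideal (MvPowerSeries (Fin e) k)) : Ideal (MvPowerSeries (Fin e) k) :=
  (socle (quotMax I)).comap (Ideal.Quotient.mk I)

lemma mem_socleIdeal {f : MvPowerSeries (Fin e) k} :
    f ∈ socleIdeal I ↔ ∀ g ∈ maxIdeal k e, f * g ∈ I := by
  rw [socleIdeal, Ideal.mem_comap, socle, Submodule.mem_annihilator]
  constructor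
  · intro h g hg
    rw [← Ideal.Quotient.eq_zero_iff_mem, map_mul]
    exact h _ (Ideal.mem_map_of_mem _ hg)
  · intro h r hr
    rw [quotMax, Ideal.mem_map_iff_of_surjective _ Ideal.Quotient.mk_surjective] at hr
    obtain ⟨g, hg, rfl⟩ := hr
    rw [smul_eq_mul, ← map_mul, Ideal.Quotient.eq_zero_iff_mem]
    exact h g hg

lemma mem_socleIdeal_iff_X {f : MvPowerSeries (Fin e) k} :
    f ∈ socleIdeal I ↔ ∀ j, f * MvPowerSeries.X j ∈ I := by
  rw [mem_socleIdeal]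
  refine ⟨fun h j => h _ (X_mem_maxIdeal j), fun h g hg => ?_⟩
  rw [← pow_one (maxIdeal k e), mem_maxIdeal_pow] at hg
  obtain ⟨c, rfl, -⟩ := exists_eq_sum_X_mul hg
  rw [Finset.mul_sum]
  refine Ideal.sum_mem _ fun j _ => ?_
  rw [← mul_assoc]
  exact Ideal.mul_mem_right _ _ (h j)

lemma le_socleIdeal : I ≤ socleIdeal I := fun _ hf =>
  mem_socleIdeal.2 fun g _ => Ideal.mul_mem_right g _ hf

lemma socleIdeal_inf (I J : Ideal (MvPowerSeries (Fin e) k)) :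
    socleIdeal (I ⊓ J) = socleIdeal I ⊓ socleIdeal J := by
  ext f
  simp only [Ideal.mem_inf, mem_socleIdeal]
  exact ⟨fun h => ⟨fun g hg => (h g hg).1, fun g hg => (h g hg).2⟩,
    fun h g hg => ⟨h.1 g hg, h.2 g hg⟩⟩

lemma isHomogeneous_X (j : Fin e) :
    (MvPowerSeries.X j : MvPowerSeries (Fin e) k).IsHomogeneous 1 := by
  classical
  intro d hd
  rw [MvPowerSeries.coeff_X] at hd
  split_ifs at hd with h
  · have := Finsupp.degree_single j (1 : ℕ)
    rw [Finsupp.degree_eq_weight_one] at this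
    rw [h]
    exact this
  · exact absurd rfl hd

lemma IsGraded.socleIdeal (hI : IsGraded I) : IsGraded (socleIdeal I) := by
  intro f hf i
  rw [mem_socleIdeal_iff_X] at hf ⊢
  intro j
  rw [← homogeneousComponent_mul i f (isHomogeneous_X j)]
  exact hI _ (hf j) _

lemma socleRank_add_finrank (hI : IsGraded I) (i : ℕ) :
    socleRank k (quotMax I) i + Module.finrank k (gradedPiece I i) =
      Module.finrank k (gradedPiece (socleIdeal I) i) := by
  refine finrank_quotient_add_finrank_gradedPiece (Ideal.Quotient.mkₐ k I).toLinearMap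
    le_socleIdeal
    (fun f hf => ⟨mem_quotMax_pow.2 ⟨f, IsHomogeneous.mem_maxIdeal_pow hf.2, rfl⟩, hf.1⟩) ?_ ?_
  · rintro a ⟨ha, hs⟩
    obtain ⟨f, hf, rfl⟩ := mem_quotMax_pow.1 ha
    have hfi := hI.socleIdeal f hs i
    refine ⟨homogeneousComponent i f, ⟨hfi, isHomogeneous_homogeneousComponent f i⟩,
      mem_quotMax_pow.2 ⟨_, sub_homogeneousComponent_mem hf, map_sub _ _ _⟩, ?_⟩
    exact sub_mem hs hfi
  · intro f hf
    rw [← mk_mem_quotMax_pow_succ hI hf.2]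
    exact ⟨fun h => h.1, fun h => ⟨h, hf.1⟩⟩

lemma maxIdeal_fg : (maxIdeal k e).FG := by
  classical
  refine ⟨Finset.univ.image MvPowerSeries.X, le_antisymm ?_ ?_⟩
  · rw [Ideal.span_le]
    intro f hf
    simp only [Finset.coe_image, Set.mem_image] at hf
    obtain ⟨j, -, rfl⟩ := hf
    exact X_mem_maxIdeal j
  · intro f hf
    rw [← pow_one (maxIdeal k e), mem_maxIdeal_pow] at hf
    obtain ⟨c, rfl, -⟩ := exists_eq_sum_X_mul hf
    refine Ideal.sum_mem _ fun j _ => Ideal.mul_mem_right _ _ (Ideal.subset_span ?_)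
    simp

lemma IsMaxPrimary.exists_pow_le (hI : IsMaxPrimary I) : ∃ n, maxIdeal k e ^ n ≤ I :=
  Ideal.exists_pow_le_of_le_radical_of_fg hI.2.ge maxIdeal_fg

lemma quotMax_pow_eq_bot {n : ℕ} : quotMax I ^ n = ⊥ ↔ maxIdeal k e ^ n ≤ I := by
  rw [quotMax, ← Ideal.map_pow, Ideal.map_eq_bot_iff_le_ker, Ideal.mk_ker]

lemma finiteDimensional_quotient {n : ℕ} (h : maxIdeal k e ^ n ≤ I) :
    FiniteDimensional k (MvPowerSeries (Fin e) k ⧸ I) := by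
  let V : Submodule k (MvPowerSeries (Fin e) k) := (Finset.range n).sup
    (gradedPiece (⊤ : Ideal (MvPowerSeries (Fin e) k)))
  have : FiniteDimensional k V := Submodule.finiteDimensional_finset_sup _ _
  refine Module.Finite.of_surjective ((Ideal.Quotient.mkₐ k I).toLinearMap.comp V.subtype) ?_
  intro r
  obtain ⟨f, rfl⟩ := Ideal.Quotient.mk_surjective r
  refine ⟨⟨∑ i ∈ Finset.range n, homogeneousComponent i f, Submodule.sum_mem _ fun i hi => ?_⟩, ?_⟩
  · exact Finset.le_sup (f := gradedPiece (⊤ : Ideal (MvPowerSeries (Fin e) k))) hi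
      ⟨trivial, isHomogeneous_homogeneousComponent f i⟩
  · exact ((Ideal.Quotient.eq.2 (h (sub_sum_homogeneousComponent_mem n f)))).symm

lemma exists_sub_algebraMap_mem_quotMax (r : MvPowerSeries (Fin e) k ⧸ I) :
    ∃ c : k, r - algebraMap k _ c ∈ quotMax I := by
  obtain ⟨f, rfl⟩ := Ideal.Quotient.mk_surjective r
  refine ⟨constantCoeff f, ?_⟩
  have : f - MvPowerSeries.C (constantCoeff f) ∈ maxIdeal k e := by
    rw [mem_maxIdeal]
    simp
  exact Ideal.mem_map_of_mem (Ideal.Quotient.mk I) this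

end Quotients

/-! ### A dimension inequality -/

section LinearAlgebra

variable {k V : Type*} [Field k] [AddCommGroup V] [Module k V]

/-- The quotient `(B ∩ C)/(A ∩ C)` embeds in `B/A`. -/
lemma finrank_inf_add_finrank_le {A B : Submodule k V} (C : Submodule k V) [FiniteDimensional k B]
    (h : A ≤ B) :
    Module.finrank k ↥(B ⊓ C) + Module.finrank k A ≤
      Module.finrank k B + Module.finrank k ↥(A ⊓ C) := by
  have : FiniteDimensional k A := Submodule.finiteDimensional_of_le h
  have h1 := Submodule.finrank_sup_add_finrank_inf_eq A (B ⊓ C)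
  rw [← inf_assoc, inf_eq_left.2 h] at h1
  have h2 := Submodule.finrank_mono (sup_le h (inf_le_left : B ⊓ C ≤ B))
  omega

end LinearAlgebra

/-! ### Socle degrees, socle ranks and initial degrees -/

section Invariants

open MvPowerSeries

variable {k : Type*} [Field k] {e : ℕ} {I I₁ I₂ : Ideal (MvPowerSeries (Fin e) k)}

lemma socleDegree_le_iff {N : ℕ} (hN : maxIdeal k e ^ N ≤ I) {n : ℕ} :
    socleDegree (quotMax I) ≤ n ↔ maxIdeal k e ^ (n + 1) ≤ I := by
  rw [← quotMax_pow_eq_bot, socleDegree]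
  -- Needed because `sInf ∅ = 0` in `ℕ`.
  have hne : {n : ℕ | quotMax I ^ (n + 1) = ⊥}.Nonempty :=
    ⟨N, quotMax_pow_eq_bot.2 ((Ideal.pow_le_pow_right N.le_succ).trans hN)⟩
  constructor
  · intro h
    have h1 : quotMax I ^ (sInf {n : ℕ | quotMax I ^ (n + 1) = ⊥} + 1) = ⊥ := Nat.sInf_mem hne
    rw [eq_bot_iff, ← h1]
    exact Ideal.pow_le_pow_right (Nat.succ_le_succ h)
  · exact fun h => Nat.sInf_le h

lemma socleDegree_inf {N₁ N₂ : ℕ} (h₁ : maxIdeal k e ^ N₁ ≤ I₁) (h₂ : maxIdeal k e ^ N₂ ≤ I₂) :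
    socleDegree (quotMax (I₁ ⊓ I₂)) = max (socleDegree (quotMax I₁)) (socleDegree (quotMax I₂)) := by
  have h : maxIdeal k e ^ (max N₁ N₂) ≤ I₁ ⊓ I₂ :=
    le_inf ((Ideal.pow_le_pow_right (le_max_left _ _)).trans h₁)
      ((Ideal.pow_le_pow_right (le_max_right _ _)).trans h₂)
  refine eq_of_forall_ge_iff fun n => ?_
  rw [socleDegree_le_iff h, max_le_iff, socleDegree_le_iff h₁, socleDegree_le_iff h₂, le_inf_iff]

lemma gradedPiece_eq_of_pow_le {n i : ℕ} (h : maxIdeal k e ^ n ≤ I) (hi : n ≤ i) :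
    gradedPiece I i = gradedPiece ⊤ i :=
  le_antisymm (gradedPiece_mono le_top i) fun _ hf =>
    ⟨h (Ideal.pow_le_pow_right hi (IsHomogeneous.mem_maxIdeal_pow hf.2)), hf.2⟩

lemma hQuot_eq_zero_of_lt (hI : IsGraded I) {N : ℕ} (hN : maxIdeal k e ^ N ≤ I) {i : ℕ}
    (hi : socleDegree (quotMax I) < i) : hQuot I i = 0 := by
  have h := hQuot_add_finrank hI i
  rw [gradedPiece_eq_of_pow_le ((socleDegree_le_iff hN).1 le_rfl) hi,
    finrank_gradedPiece_top] at h
  omega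

lemma hQuot_socleDegree_pos (hI : IsGraded I) (hne : I ≠ ⊤) {N : ℕ} (hN : maxIdeal k e ^ N ≤ I) :
    0 < hQuot I (socleDegree (quotMax I)) := by
  set s := socleDegree (quotMax I) with hs
  have hs1 : maxIdeal k e ^ (s + 1) ≤ I := (socleDegree_le_iff hN).1 le_rfl
  by_contra h0
  have h := hQuot_add_finrank hI s
  rw [Nat.eq_zero_of_not_pos h0, zero_add, ← finrank_gradedPiece_top (k := k)] at h
  have heq := Submodule.eq_of_le_of_finrank_eq (gradedPiece_mono (le_top : I ≤ ⊤) s) h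
  have hle : maxIdeal k e ^ s ≤ I := by
    intro f hf
    have h1 : homogeneousComponent s f ∈ gradedPiece I s := by
      rw [heq]
      exact ⟨trivial, isHomogeneous_homogeneousComponent f s⟩
    have h2 := I.add_mem (hs1 (sub_homogeneousComponent_mem hf)) h1.1
    rwa [sub_add_cancel] at h2
  -- For `s > 0` the inclusion `q^s ⊆ I` contradicts minimality of `s`; for `s = 0` it says `I = ⊤`.
  rcases Nat.eq_zero_or_pos s with h' | h'
  · rw [h', pow_zero, Ideal.one_eq_top, top_le_iff] at hle
    exact hne hle
  · obtain ⟨m, hm⟩ := Nat.exists_eq_add_of_le' h'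
    rw [hm] at hle
    have := (socleDegree_le_iff hN).2 hle
    omega

lemma type_eq_sum_socleRank {n : ℕ} (h : maxIdeal k e ^ n ≤ I) :
    type k (quotMax I) = ∑ i ∈ Finset.range n, socleRank k (quotMax I) i :=
  have := finiteDimensional_quotient h
  finrank_socle_eq_sum_socleRank (quotMax_pow_eq_bot.2 h)

lemma socleRank_le_hQuot (hI : IsGraded I) (i : ℕ) : socleRank k (quotMax I) i ≤ hQuot I i := by
  have h1 := socleRank_add_finrank hI i
  have h2 := hQuot_add_finrank hI i
  have h3 := Submodule.finrank_mono (gradedPiece_mono (le_top : socleIdeal I ≤ ⊤) i)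
  rw [finrank_gradedPiece_top] at h3
  omega

lemma socleRank_eq_zero_of_lt (hI : IsGraded I) {N : ℕ} (hN : maxIdeal k e ^ N ≤ I) {i : ℕ}
    (hi : socleDegree (quotMax I) < i) : socleRank k (quotMax I) i = 0 := by
  have h1 := socleRank_le_hQuot hI i
  rw [hQuot_eq_zero_of_lt hI hN hi] at h1
  omega

lemma socleRank_socleDegree_pos (hI : IsGraded I) (hne : I ≠ ⊤) {N : ℕ}
    (hN : maxIdeal k e ^ N ≤ I) :
    0 < socleRank k (quotMax I) (socleDegree (quotMax I)) := by
  have h0 := hQuot_socleDegree_pos hI hne hN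
  set s := socleDegree (quotMax I) with hs
  have hs1 : maxIdeal k e ^ (s + 1) ≤ I := (socleDegree_le_iff hN).1 le_rfl
  have h1 := socleRank_add_finrank hI s
  have h2 := hQuot_add_finrank hI s
  have h3 : gradedPiece (socleIdeal I) s = gradedPiece ⊤ s := by
    refine gradedPiece_eq_of_pow_le (n := s) (fun f hf => ?_) le_rfl
    rw [mem_socleIdeal]
    intro g hg
    apply hs1
    rw [pow_succ]
    exact Ideal.mul_mem_mul hf hg
  rw [h3, finrank_gradedPiece_top] at h1
  omega

/-- The socle ranks add up to 1, and the one in the socle degree is already positive. -/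
lemma IsGorensteinQuot.socleRank_eq (hgor : IsGorensteinQuot I) (hI : IsGraded I) (hne : I ≠ ⊤)
    {N : ℕ} (hN : maxIdeal k e ^ N ≤ I) (i : ℕ) :
    socleRank k (quotMax I) i = if i = socleDegree (quotMax I) then 1 else 0 := by
  have hpos := socleRank_socleDegree_pos hI hne hN
  have hzero := @socleRank_eq_zero_of_lt _ _ _ _ hI N hN i
  set s := socleDegree (quotMax I) with hs
  have hsum := type_eq_sum_socleRank ((socleDegree_le_iff hN).1 hs.ge)
  rw [IsGorensteinQuot] at hgor
  rw [hgor, ← Finset.sum_erase_add _ _ (Finset.self_mem_range_succ s)] at hsum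
  split_ifs with h
  · subst h
    omega
  · rcases lt_or_ge s i with h' | h'
    · exact hzero h'
    · have : i ∈ (Finset.range (s + 1)).erase s := by
        rw [Finset.mem_erase, Finset.mem_range]
        omega
      have := Finset.single_le_sum (f := fun i => socleRank k (quotMax I) i)
        (fun _ _ => Nat.zero_le _) this
      omega

lemma coeff_soclePolynomial (hI : IsGraded I) {N : ℕ} (hN : maxIdeal k e ^ N ≤ I) (j : ℕ) :
    (soclePolynomial k (quotMax I)).coeff j = socleRank k (quotMax I) j := by
  rw [soclePolynomial, Polynomial.finsetSum_coeff]
  simp only [Polynomial.coeff_monomial, Finset.sum_ite_eq', Finset.mem_range]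
  split_ifs with h
  · rfl
  · exact (socleRank_eq_zero_of_lt hI hN (by omega)).symm

/-- `h_Q(s - i)`, zero at negative integers. -/
def dualRank (e s i : ℕ) : ℕ := if i ≤ s then formsRank e (s - i) else 0

lemma sum_Icc_ite_mul (e : ℕ) {a s : ℕ} (h : a ≤ s) (i : ℕ) :
    ∑ j ∈ Finset.Icc i s, (if j = a then 1 else 0) * formsRank e (j - i) = dualRank e a i := by
  simp only [ite_mul, one_mul, zero_mul, Finset.sum_ite_eq', Finset.mem_Icc, h, and_true]
  rfl

lemma IsGorensteinQuot.isCompressedQuot_iff (hgor : IsGorensteinQuot I) (hI : IsGraded I)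
    (hne : I ≠ ⊤) {N : ℕ} (hN : maxIdeal k e ^ N ≤ I) :
    IsCompressedQuot I ↔
      ∀ i, hQuot I i = min (formsRank e i) (dualRank e (socleDegree (quotMax I)) i) := by
  simp only [IsCompressedQuot, hQ_eq, coeff_soclePolynomial hI hN,
    hgor.socleRank_eq hI hne hN, sum_Icc_ite_mul e le_rfl]

lemma hQuot_mono (hI₁ : IsGraded I₁) (hI₂ : IsGraded I₂) (h : I₁ ≤ I₂) (i : ℕ) :
    hQuot I₂ i ≤ hQuot I₁ i := by
  have h1 := hQuot_add_finrank hI₁ i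
  have h2 := hQuot_add_finrank hI₂ i
  have h3 := Submodule.finrank_mono (gradedPiece_mono h i)
  omega

lemma hQuot_le (hI : IsGraded I) (i : ℕ) : hQuot I i ≤ formsRank e i := by
  have := hQuot_add_finrank hI i
  omega

lemma hQuot_inf_le (hI₁ : IsGraded I₁) (hI₂ : IsGraded I₂) (i : ℕ) :
    hQuot (I₁ ⊓ I₂) i ≤ hQuot I₁ i + hQuot I₂ i := by
  have h := hQuot_add_finrank (hI₁.inf hI₂) i
  have h1 := hQuot_add_finrank hI₁ i
  have h2 := hQuot_add_finrank hI₂ i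
  have h3 := Submodule.finrank_sup_add_finrank_inf_eq (gradedPiece I₁ i) (gradedPiece I₂ i)
  have h4 := Submodule.finrank_mono (sup_le (gradedPiece_mono (le_top : I₁ ≤ ⊤) i)
    (gradedPiece_mono (le_top : I₂ ≤ ⊤) i))
  rw [finrank_gradedPiece_top] at h4
  rw [gradedPiece_inf] at h
  omega

/-- Going from `(I₁ : q) ∩ (I₂ : q)` to `I₁ ∩ (I₂ : q)` and on to `I₁ ∩ I₂`, the dimension drops at
each stage by at most one of the two socle ranks. -/
lemma socleRank_inf_le (hI₁ : IsGraded I₁) (hI₂ : IsGraded I₂) (i : ℕ) :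
    socleRank k (quotMax (I₁ ⊓ I₂)) i ≤
      socleRank k (quotMax I₁) i + socleRank k (quotMax I₂) i := by
  have h := socleRank_add_finrank (hI₁.inf hI₂) i
  have h1 := socleRank_add_finrank hI₁ i
  have h2 := socleRank_add_finrank hI₂ i
  have h3 := finrank_inf_add_finrank_le (gradedPiece (socleIdeal I₂) i)
    (gradedPiece_mono (le_socleIdeal (I := I₁)) i)
  have h4 := finrank_inf_add_finrank_le (gradedPiece I₁ i)
    (gradedPiece_mono (le_socleIdeal (I := I₂)) i)
  rw [inf_comm, inf_comm (gradedPiece I₂ i)] at h4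
  rw [socleIdeal_inf, gradedPiece_inf, gradedPiece_inf] at h
  omega

/-- The socle of `Q/(I₁ ∩ I₂)` embeds in the sum of the socles of `Q/I₁` and `Q/I₂`, and fills it
if it has rank two. -/
lemma socleRank_inf_eq (hI₁ : IsGraded I₁) (hI₂ : IsGraded I₂) (hne₁ : I₁ ≠ ⊤) (hne₂ : I₂ ≠ ⊤)
    {N₁ N₂ : ℕ} (hN₁ : maxIdeal k e ^ N₁ ≤ I₁) (hN₂ : maxIdeal k e ^ N₂ ≤ I₂)
    (hgor₁ : IsGorensteinQuot I₁) (hgor₂ : IsGorensteinQuot I₂)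
    (htype : type k (quotMax (I₁ ⊓ I₂)) = 2) (i : ℕ) :
    socleRank k (quotMax (I₁ ⊓ I₂)) i =
      (if i = socleDegree (quotMax I₁) then 1 else 0) +
        if i = socleDegree (quotMax I₂) then 1 else 0 := by
  have hN : maxIdeal k e ^ (max N₁ N₂) ≤ I₁ ⊓ I₂ :=
    le_inf ((Ideal.pow_le_pow_right (le_max_left _ _)).trans hN₁)
      ((Ideal.pow_le_pow_right (le_max_right _ _)).trans hN₂)
  have hs := socleDegree_inf hN₁ hN₂
  have hle := socleRank_inf_le hI₁ hI₂
  simp only [hgor₁.socleRank_eq hI₁ hne₁ hN₁, hgor₂.socleRank_eq hI₂ hne₂ hN₂] at hle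
  have hsum := type_eq_sum_socleRank ((socleDegree_le_iff hN).1 le_rfl)
  have hsum' : ∑ i ∈ Finset.range (socleDegree (quotMax (I₁ ⊓ I₂)) + 1),
      ((if i = socleDegree (quotMax I₁) then 1 else 0) +
        if i = socleDegree (quotMax I₂) then 1 else 0) = 2 := by
    rw [Finset.sum_add_distrib]
    simp only [Finset.sum_ite_eq', Finset.mem_range]
    rw [if_pos (by omega), if_pos (by omega)]
  rcases lt_or_ge (socleDegree (quotMax (I₁ ⊓ I₂))) i with h | h
  · rw [socleRank_eq_zero_of_lt (hI₁.inf hI₂) hN h, if_neg (by omega), if_neg (by omega)]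
  -- The termwise bounds have total 2, equal to the type, so each of them is attained.
  · exact (Finset.sum_eq_sum_iff_of_le fun i _ => hle i).1
      (hsum.symm.trans (htype.trans hsum'.symm)) i (Finset.mem_range.2 (by omega))

lemma le_maxIdeal_pow_succ_iff (hI : IsGraded I) {n : ℕ} :
    I ≤ maxIdeal k e ^ (n + 1) ↔ ∀ i ≤ n, formsRank e i ≤ hQuot I i := by
  have hbot : ∀ i, formsRank e i ≤ hQuot I i ↔ gradedPiece I i = ⊥ := by
    intro i
    rw [← Submodule.finrank_eq_zero]
    have := hQuot_add_finrank hI i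
    omega
  simp only [hbot]
  constructor
  · intro h i hi
    rw [eq_bot_iff]
    intro f hf
    rw [Submodule.mem_bot, ← homogeneousComponent_eq_self hf.2]
    exact homogeneousComponent_of_mem_pow (Nat.lt_succ_of_le hi) (h hf.1)
  · intro h f hf
    have hz : ∑ i ∈ Finset.range (n + 1), homogeneousComponent i f = 0 := by
      refine Finset.sum_eq_zero fun i hi => ?_
      have : homogeneousComponent i f ∈ gradedPiece I i :=
        ⟨hI f hf i, isHomogeneous_homogeneousComponent f i⟩
      rwa [h i (by rw [Finset.mem_range] at hi; omega), Submodule.mem_bot] at this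
    have := sub_sum_homogeneousComponent_mem (n + 1) f
    rwa [hz, sub_zero] at this

lemma formsRank_strictMono (he : 3 ≤ e) : StrictMono (formsRank e) :=
  strictMono_nat_of_lt_succ fun i => by
    have := formsRank_add_two_le he i
    omega

lemma formsRank_pos (he : 3 ≤ e) (i : ℕ) : 0 < formsRank e i := by
  have := (formsRank_strictMono he).monotone (Nat.zero_le i)
  rw [formsRank_zero] at this
  omega

lemma isLeast_initialDegree (he : 3 ≤ e) (hI : IsGraded I) {N : ℕ} (hN : maxIdeal k e ^ N ≤ I) :
    IsLeast {i | hQuot I i < formsRank e i} (initialDegree I) := by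
  have hmem : ∀ n, n ∈ {n : ℕ | ¬ I ≤ maxIdeal k e ^ (n + 1)} ↔
      ∃ i ≤ n, hQuot I i < formsRank e i := by
    intro n
    rw [Set.mem_ofPred_eq, le_maxIdeal_pow_succ_iff hI]
    push Not
    rfl
  have hne : {n : ℕ | ¬ I ≤ maxIdeal k e ^ (n + 1)}.Nonempty :=
    ⟨socleDegree (quotMax I) + 1, (hmem _).2 ⟨_, le_rfl, by
      rw [hQuot_eq_zero_of_lt hI hN (Nat.lt_succ_self _)]
      exact formsRank_pos he _⟩⟩
  constructor
  · obtain ⟨i, hi, h⟩ := (hmem _).1 (Nat.sInf_mem hne)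
    have : initialDegree I ≤ i := Nat.sInf_le ((hmem i).2 ⟨i, le_rfl, h⟩)
    rw [le_antisymm this hi]
    exact h
  · intro i hi
    exact Nat.sInf_le ((hmem i).2 ⟨i, le_rfl, hi⟩)

/-- If `Q/I` has a socle in the socle degree only, a form `f` of degree `d ≤ s` that is killed by
the forms of degree `s - d` lies in `I`. -/
lemma IsGorensteinQuot.mem_of_mul_mem (hgor : IsGorensteinQuot I) (hI : IsGraded I) (hne : I ≠ ⊤)
    {N : ℕ} (hN : maxIdeal k e ^ N ≤ I) {n d : ℕ} (hd : d + n = socleDegree (quotMax I))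
    {f : MvPowerSeries (Fin e) k} (hf : f.IsHomogeneous d)
    (h : ∀ g ∈ maxIdeal k e ^ n, f * g ∈ I) : f ∈ I := by
  induction n generalizing d f with
  | zero =>
    have := h 1 (by simp)
    rwa [mul_one] at this
  | succ n ih =>
    have hsoc : f ∈ gradedPiece (socleIdeal I) d := by
      refine ⟨mem_socleIdeal_iff_X.2 fun j => ?_, hf⟩
      refine ih (d := d + 1) (by omega) (MvPowerSeries.IsHomogeneous.mul hf (isHomogeneous_X j))
        fun g hg => ?_
      rw [mul_assoc]
      apply h
      rw [pow_succ']
      exact Ideal.mul_mem_mul (X_mem_maxIdeal j) hg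
    -- By induction `f` lies in `(I : q)`; as `d` is below the socle degree, there is no socle in
    -- degree `d`, and so `f ∈ I`.
    have h1 := socleRank_add_finrank hI d
    rw [hgor.socleRank_eq hI hne hN, if_neg (by omega), zero_add] at h1
    rw [← Submodule.eq_of_le_of_finrank_eq (gradedPiece_mono le_socleIdeal d) h1] at hsoc
    exact hsoc.1

end Invariants

/-! ### Numerical comparison of `h_Q(i)` with `h_Q(s - i)` -/

section Ranks

variable {e : ℕ}

lemma dualRank_of_lt {s i : ℕ} (h : s < i) : dualRank e s i = 0 := if_neg (by omega)

lemma dualRank_of_le {s i : ℕ} (h : i ≤ s) : dualRank e s i = formsRank e (s - i) := if_pos h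

lemma dualRank_pos (he : 3 ≤ e) {s i : ℕ} (h : i ≤ s) : 0 < dualRank e s i := by
  rw [dualRank_of_le h]
  exact formsRank_pos he _

lemma dualRank_mono (he : 3 ≤ e) {s s' i i' : ℕ} (hs : s ≤ s') (hi : i' ≤ i) :
    dualRank e s i ≤ dualRank e s' i' := by
  rcases lt_or_ge s i with h | h
  · rw [dualRank_of_lt h]
    exact Nat.zero_le _
  · rw [dualRank_of_le h, dualRank_of_le (by omega)]
    exact (formsRank_strictMono he).monotone (by omega)

lemma dualRank_lt_formsRank_iff (he : 3 ≤ e) {s i : ℕ} :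
    dualRank e s i < formsRank e i ↔ s < 2 * i := by
  rcases lt_or_ge s i with h | h
  · rw [dualRank_of_lt h]
    exact ⟨fun _ => by omega, fun _ => formsRank_pos he i⟩
  · rw [dualRank_of_le h, (formsRank_strictMono he).lt_iff_lt]
    omega

lemma formsRank_lt_dualRank_iff (he : 3 ≤ e) {s i : ℕ} :
    formsRank e i < dualRank e s i ↔ 2 * i < s := by
  rcases lt_or_ge s i with h | h
  · rw [dualRank_of_lt h]
    omega
  · rw [dualRank_of_le h, (formsRank_strictMono he).lt_iff_lt]
    omega

/-- Here `s - i ≤ i - 1`, and `h_Q` grows by at least 2 from `i - 1` to `i`. In the application `i =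
s₁`, and the summand 1 is `h_{R₁}(s₁)`. -/
lemma one_add_dualRank_lt (he : 3 ≤ e) {s i : ℕ} (hi : i ≤ s) (h : s < 2 * i) :
    1 + dualRank e s i < formsRank e i := by
  obtain ⟨j, rfl⟩ : ∃ j, i = j + 1 := Nat.exists_eq_add_of_le' (by omega)
  rw [dualRank_of_le hi]
  have h1 : formsRank e (s - (j + 1)) ≤ formsRank e j :=
    (formsRank_strictMono he).monotone (by omega)
  have h2 := formsRank_add_two_le he j
  omega

/-- Equality at `i` forces both minima to be the dual ranks. Their sum is nonincreasing while `h_Q`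
strictly increases, so the sum falls below `h_Q` at `i + 1` and at no earlier degree. -/
lemma eq_add_one_of_formsRank_eq (he : 3 ≤ e) {s₁ s₂ t i : ℕ} (hle : s₁ ≤ s₂) (hlt : s₂ < 2 * s₁)
    (ht : IsLeast {i | min (formsRank e i) (dualRank e s₁ i) +
      min (formsRank e i) (dualRank e s₂ i) < formsRank e i} t)
    (hi : formsRank e i = min (formsRank e i) (dualRank e s₁ i) +
      min (formsRank e i) (dualRank e s₂ i)) : t = i + 1 := by
  have hN := formsRank_pos he i
  have h12 := dualRank_mono he hle (le_refl i)
  have hsum : formsRank e i = dualRank e s₁ i + dualRank e s₂ i := by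
    have h1 : ¬ formsRank e i < dualRank e s₁ i := fun h => by omega
    -- Otherwise the first minimum vanishes, so `s₁ < i`, while `2i < s₂ < 2s₁`.
    have h2 : ¬ formsRank e i < dualRank e s₂ i := fun h => by
      have h3 : dualRank e s₁ i = 0 := by omega
      have h4 := (formsRank_lt_dualRank_iff he).1 h
      have h5 : ¬ i ≤ s₁ := fun h' => by
        have := dualRank_pos he h'
        omega
      omega
    omega
  apply le_antisymm
  · apply ht.2
    have h1 := dualRank_mono he (le_refl s₁) i.le_succ
    have h2 := dualRank_mono he (le_refl s₂) i.le_succ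
    have h3 := formsRank_strictMono he i.lt_succ_self
    simp only [Set.mem_ofPred_eq, Nat.succ_eq_add_one] at *
    omega
  · by_contra hti
    have h0 := ht.1
    have h1 := dualRank_mono he (le_refl s₁) (show t ≤ i by omega)
    have h2 := dualRank_mono he (le_refl s₂) (show t ≤ i by omega)
    have h3 := (formsRank_strictMono he).monotone (show t ≤ i by omega)
    rw [Set.mem_ofPred_eq] at h0
    omega

end Ranks

/-! ### The intersection of two compressed Gorenstein ideals -/

section Intersections

open MvPowerSeries

variable {k : Type*} [Field k] {e : ℕ} {I I₁ I₂ : Ideal (MvPowerSeries (Fin e) k)}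

lemma ne_top_of_le_sq (h : I ≤ maxIdeal k e ^ 2) : I ≠ ⊤ := by
  rintro rfl
  have h1 : (1 : MvPowerSeries (Fin e) k) ∈ maxIdeal k e := Ideal.pow_le_self two_ne_zero (h trivial)
  rw [mem_maxIdeal, map_one] at h1
  exact one_ne_zero h1

lemma length_quotient_eq_sum {n : ℕ} (h : maxIdeal k e ^ n ≤ I) :
    Module.length (MvPowerSeries (Fin e) k ⧸ I) (MvPowerSeries (Fin e) k ⧸ I) =
      ((∑ i ∈ Finset.range n, hQuot I i : ℕ) : ℕ∞) := by
  have := finiteDimensional_quotient h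
  have hm : quotMax I ^ n = ⊥ := quotMax_pow_eq_bot.2 h
  have := length_eq_sum_hilbertFunction (k := k) exists_sub_algebraMap_mem_quotMax hm
  simp only [hQuot]
  exact this

lemma hQuot_inf_le_min (hI₁ : IsGraded I₁) (hI₂ : IsGraded I₂) (i : ℕ) :
    hQuot (I₁ ⊓ I₂) i ≤ min (formsRank e i) (hQuot I₁ i + hQuot I₂ i) :=
  le_min (hQuot_le (hI₁.inf hI₂) i) (hQuot_inf_le hI₁ hI₂ i)

/-- With the socle ranks known, this is the identity `min (h, a + b) = min (h, min (h, a) + min (h,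
b))`. -/
lemma isCompressedQuot_inf_iff (hI₁ : IsGraded I₁) (hI₂ : IsGraded I₂) (hne₁ : I₁ ≠ ⊤)
    (hne₂ : I₂ ≠ ⊤) {N₁ N₂ : ℕ} (hN₁ : maxIdeal k e ^ N₁ ≤ I₁) (hN₂ : maxIdeal k e ^ N₂ ≤ I₂)
    (hgor₁ : IsGorensteinQuot I₁) (hgor₂ : IsGorensteinQuot I₂)
    (hcomp₁ : IsCompressedQuot I₁) (hcomp₂ : IsCompressedQuot I₂)
    (htype : type k (quotMax (I₁ ⊓ I₂)) = 2) :
    IsCompressedQuot (I₁ ⊓ I₂) ↔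
      ∀ i, hQuot (I₁ ⊓ I₂) i = min (formsRank e i) (hQuot I₁ i + hQuot I₂ i) := by
  have hN : maxIdeal k e ^ (max N₁ N₂) ≤ I₁ ⊓ I₂ :=
    le_inf ((Ideal.pow_le_pow_right (le_max_left _ _)).trans hN₁)
      ((Ideal.pow_le_pow_right (le_max_right _ _)).trans hN₂)
  have hs := socleDegree_inf hN₁ hN₂
  rw [hgor₁.isCompressedQuot_iff hI₁ hne₁ hN₁] at hcomp₁
  rw [hgor₂.isCompressedQuot_iff hI₂ hne₂ hN₂] at hcomp₂
  rw [IsCompressedQuot]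
  refine forall_congr' fun i => ?_
  simp only [hQ_eq, coeff_soclePolynomial (hI₁.inf hI₂) hN,
    socleRank_inf_eq hI₁ hI₂ hne₁ hne₂ hN₁ hN₂ hgor₁ hgor₂ htype, add_mul,
    Finset.sum_add_distrib]
  rw [sum_Icc_ite_mul e (by omega), sum_Icc_ite_mul e (by omega), hcomp₁ i, hcomp₂ i]
  omega

lemma soclePolynomial_inf_eq (hI₁ : IsGraded I₁) (hI₂ : IsGraded I₂) (hne₁ : I₁ ≠ ⊤)
    (hne₂ : I₂ ≠ ⊤) {N₁ N₂ : ℕ} (hN₁ : maxIdeal k e ^ N₁ ≤ I₁) (hN₂ : maxIdeal k e ^ N₂ ≤ I₂)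
    (hgor₁ : IsGorensteinQuot I₁) (hgor₂ : IsGorensteinQuot I₂)
    (htype : type k (quotMax (I₁ ⊓ I₂)) = 2) :
    soclePolynomial k (quotMax (I₁ ⊓ I₂)) =
      Polynomial.X ^ socleDegree (quotMax I₁) + Polynomial.X ^ socleDegree (quotMax I₂) := by
  have hN : maxIdeal k e ^ (max N₁ N₂) ≤ I₁ ⊓ I₂ :=
    le_inf ((Ideal.pow_le_pow_right (le_max_left _ _)).trans hN₁)
      ((Ideal.pow_le_pow_right (le_max_right _ _)).trans hN₂)
  ext j
  rw [coeff_soclePolynomial (hI₁.inf hI₂) hN,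
    socleRank_inf_eq hI₁ hI₂ hne₁ hne₂ hN₁ hN₂ hgor₁ hgor₂ htype, Polynomial.coeff_add,
    Polynomial.coeff_X_pow, Polynomial.coeff_X_pow]

/-- A socle element of `Q/(I₁ ∩ I₂)` in the smaller socle degree lies in `I₂`. -/
lemma hQuot_lt_of_type_eq_two (hI₁ : IsGraded I₁) (hI₂ : IsGraded I₂) (hne₁ : I₁ ≠ ⊤)
    (hne₂ : I₂ ≠ ⊤) {N₁ N₂ : ℕ} (hN₁ : maxIdeal k e ^ N₁ ≤ I₁) (hN₂ : maxIdeal k e ^ N₂ ≤ I₂)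
    (hgor₁ : IsGorensteinQuot I₁) (hgor₂ : IsGorensteinQuot I₂)
    (htype : type k (quotMax (I₁ ⊓ I₂)) = 2)
    (hlt : socleDegree (quotMax I₁) < socleDegree (quotMax I₂)) :
    hQuot I₂ (socleDegree (quotMax I₁)) < formsRank e (socleDegree (quotMax I₁)) := by
  have h := socleRank_inf_eq hI₁ hI₂ hne₁ hne₂ hN₁ hN₂ hgor₁ hgor₂ htype
    (socleDegree (quotMax I₁))
  have h2 := hgor₂.socleRank_eq hI₂ hne₂ hN₂ (socleDegree (quotMax I₁))
  rw [if_pos rfl, if_neg hlt.ne] at h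
  rw [if_neg hlt.ne] at h2
  have h3 := socleRank_add_finrank (hI₁.inf hI₂) (socleDegree (quotMax I₁))
  have h4 := socleRank_add_finrank hI₂ (socleDegree (quotMax I₁))
  have h5 := hQuot_add_finrank hI₂ (socleDegree (quotMax I₁))
  -- In degree `s₁` one has `0 ≠ (I : q) ⊆ (I₂ : q) = I₂`, the last because `R₂` has no socle there.
  have h6 := Submodule.finrank_mono (gradedPiece_mono
    ((socleIdeal_inf I₁ I₂).le.trans inf_le_right) (socleDegree (quotMax I₁)))
  omega

/-- If `q^n I₂ ⊆ I₁` with `n ≤ s₁ - d`, the forms of degree `d` in `I₂` lie in `I₁`. -/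
lemma gradedPiece_le_of_pow_mul_le (hI₁ : IsGraded I₁) (hne₁ : I₁ ≠ ⊤) {N₁ : ℕ}
    (hN₁ : maxIdeal k e ^ N₁ ≤ I₁) (hgor₁ : IsGorensteinQuot I₁) {n d : ℕ}
    (hd : d + n ≤ socleDegree (quotMax I₁)) (h : maxIdeal k e ^ n * I₂ ≤ I₁) :
    gradedPiece I₂ d ≤ gradedPiece I₁ d := by
  intro f hf
  refine ⟨hgor₁.mem_of_mul_mem hI₁ hne₁ hN₁ (n := socleDegree (quotMax I₁) - d) (by omega) hf.2
    fun g hg => h ?_, hf.2⟩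
  rw [mul_comm f g]
  exact Ideal.mul_mem_mul (Ideal.pow_le_pow_right (by omega) hg) hf.1

end Intersections

end CompressedRings

/-! ### The main theorem -/

open CompressedRings Polynomial in
theorem mainTheorem7 {k : Type*} [Field k] {e : ℕ} (he : 3 ≤ e)
    (I₁ I₂ : Ideal (MvPowerSeries (Fin e) k))
    (hhom₁ : IsHomogeneousIdeal I₁) (hhom₂ : IsHomogeneousIdeal I₂)
    (hprim₁ : IsMaxPrimary I₁) (hprim₂ : IsMaxPrimary I₂)
    (hsq₁ : I₁ ≤ maxIdeal k e ^ 2) (hsq₂ : I₂ ≤ maxIdeal k e ^ 2)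
    (hgor₁ : IsGorensteinQuot I₁) (hgor₂ : IsGorensteinQuot I₂)
    (hcomp₁ : IsCompressedQuot I₁) (hcomp₂ : IsCompressedQuot I₂)
    (t₁ t₂ t s₁ s₂ s : ℕ)
    (ht₁ : t₁ = initialDegree I₁) (ht₂ : t₂ = initialDegree I₂)
    (ht : t = initialDegree (I₁ ⊓ I₂))
    (hs₁ : s₁ = socleDegree (quotMax I₁)) (hs₂ : s₂ = socleDegree (quotMax I₂))
    (hs : s = socleDegree (quotMax (I₁ ⊓ I₂)))
    (hle : s₁ ≤ s₂)
    (htype : type k (quotMax (I₁ ⊓ I₂)) = 2) :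
    Module.length (MvPowerSeries (Fin e) k ⧸ (I₁ ⊓ I₂)) (MvPowerSeries (Fin e) k ⧸ (I₁ ⊓ I₂)) ≤
        ((∑ i ∈ Finset.range (s + 1), min (hQ k e i) (hQuot I₁ i + hQuot I₂ i) : ℕ) : ℕ∞) ∧
    (Module.length (MvPowerSeries (Fin e) k ⧸ (I₁ ⊓ I₂)) (MvPowerSeries (Fin e) k ⧸ (I₁ ⊓ I₂)) =
        ((∑ i ∈ Finset.range (s + 1), min (hQ k e i) (hQuot I₁ i + hQuot I₂ i) : ℕ) : ℕ∞) ↔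
      IsCompressedQuot (I₁ ⊓ I₂)) ∧
    (IsCompressedQuot (I₁ ⊓ I₂) →
      (2 ≤ t₁ ∧ t₁ ≤ t₂ ∧ t₂ ≤ t ∧ t ≤ s₁ ∧ s₁ ≤ s ∧ s < 2 * s₁) ∧
      (∀ i, hQuot (I₁ ⊓ I₂) i = min (hQ k e i) (hQuot I₁ i + hQuot I₂ i)) ∧
      IsLeast {i | hQuot I₁ i + hQuot I₂ i < hQ k e i} t ∧
      (∀ i, hQ k e i = hQuot I₁ i + hQuot I₂ i → t = i + 1) ∧
      soclePolynomial k (quotMax (I₁ ⊓ I₂)) = X ^ s₁ + X ^ s ∧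
      IsLeast {i | maxIdeal k e ^ i * I₂ ≤ I₁} (s₁ - t₂ + 1)) := by
  have hI₁ := hhom₁.isGraded
  have hI₂ := hhom₂.isGraded
  have hI := hI₁.inf hI₂
  have hne₁ := ne_top_of_le_sq hsq₁
  have hne₂ := ne_top_of_le_sq hsq₂
  obtain ⟨N₁, hN₁⟩ := hprim₁.exists_pow_le
  obtain ⟨N₂, hN₂⟩ := hprim₂.exists_pow_le
  have hN : maxIdeal k e ^ (max N₁ N₂) ≤ I₁ ⊓ I₂ :=
    le_inf ((Ideal.pow_le_pow_right (le_max_left _ _)).trans hN₁)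
      ((Ideal.pow_le_pow_right (le_max_right _ _)).trans hN₂)
  have hiff := isCompressedQuot_inf_iff hI₁ hI₂ hne₁ hne₂ hN₁ hN₂ hgor₁ hgor₂ hcomp₁ hcomp₂ htype
  have hle' := hQuot_inf_le_min hI₁ hI₂
  have hlen := length_quotient_eq_sum ((socleDegree_le_iff hN).1 hs.ge)
  have hzero := fun i => @hQuot_eq_zero_of_lt _ _ _ _ hI _ hN i
  have hss : s = s₂ := by
    rw [hs, socleDegree_inf hN₁ hN₂, ← hs₁, ← hs₂, max_eq_right hle]
  have hz₁ := fun i => @hQuot_eq_zero_of_lt _ _ _ _ hI₁ _ hN₁ i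
  have hz₂ := fun i => @hQuot_eq_zero_of_lt _ _ _ _ hI₂ _ hN₂ i
  rw [← hs₁] at hz₁
  rw [← hs₂] at hz₂
  have hsoc := soclePolynomial_inf_eq hI₁ hI₂ hne₁ hne₂ hN₁ hN₂ hgor₁ hgor₂ htype
  have hlt := hQuot_lt_of_type_eq_two hI₁ hI₂ hne₁ hne₂ hN₁ hN₂ hgor₁ hgor₂ htype
  rw [hgor₁.isCompressedQuot_iff hI₁ hne₁ hN₁, ← hs₁] at hcomp₁
  rw [hgor₂.isCompressedQuot_iff hI₂ hne₂ hN₂, ← hs₂] at hcomp₂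
  have hT₁ := isLeast_initialDegree he hI₁ hN₁
  have hT₂ := isLeast_initialDegree he hI₂ hN₂
  have hT := isLeast_initialDegree he hI hN
  rw [← ht₁] at hT₁
  rw [← ht₂] at hT₂
  rw [← ht] at hT
  rw [← hs₁, ← hs₂, ← hss] at hsoc
  rw [← hs₁, ← hs₂] at hlt
  simp only [hQ_eq]
  rw [hlen]
  refine ⟨?_, ?_, ?_⟩
  · exact_mod_cast Finset.sum_le_sum fun i _ => hle' i
  · rw [hiff, Nat.cast_inj, Finset.sum_eq_sum_iff_of_le fun i _ => hle' i]
    refine ⟨fun h i => ?_, fun h i _ => h i⟩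
    -- Equality of the sums controls only degrees up to `s`; above `s` all three Hilbert functions
    -- vanish.
    by_cases hi : i ∈ Finset.range (s + 1)
    · exact h i hi
    · rw [Finset.mem_range] at hi
      rw [hzero i (by omega), hz₁ i (by omega), hz₂ i (by omega), add_zero, min_eq_right]
      exact Nat.zero_le _
  · intro hc
    rw [hiff] at hc
    have h2t : 2 ≤ t₁ := by
      by_contra h
      have h1 : I₁ ≤ maxIdeal k e ^ (t₁ + 1) := hsq₁.trans (Ideal.pow_le_pow_right (by omega))
      have h2 := (le_maxIdeal_pow_succ_iff hI₁).1 h1 t₁ le_rfl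
      exact absurd hT₁.1 (not_lt.2 h2)
    have h12 : t₁ ≤ t₂ := by
      apply hT₁.2
      have h1 := hT₂.1
      have h2 := dualRank_mono he hle (le_refl t₂)
      rw [Set.mem_ofPred_eq, hcomp₂] at h1
      rw [Set.mem_ofPred_eq, hcomp₁]
      omega
    have h2t' : t₂ ≤ t := hT₂.2 (lt_of_le_of_lt (hQuot_mono hI hI₂ inf_le_right t) hT.1)
    have hs₁2 : 2 ≤ s₁ := by
      by_contra h
      have h1 : hQuot I₁ 1 < formsRank e 1 := by
        rw [hcomp₁, min_lt_iff]
        exact Or.inr ((dualRank_lt_formsRank_iff he).2 (by omega))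
      have := hT₁.2 h1
      omega
    have hs2 : s₂ < 2 * s₁ := by
      -- If `s₁ = s₂`, positivity of `s₁` suffices; otherwise `h_Q(s₂ - s₁) < h_Q(s₁)` by the
      -- nonzero form of degree `s₁` in `I₂`.
      rcases hle.eq_or_lt with h | h
      · omega
      · have h1 := hlt h
        rw [hcomp₂, min_lt_iff] at h1
        exact (dualRank_lt_formsRank_iff he).1 (h1.resolve_left (lt_irrefl _))
    have hts : t ≤ s₁ := by
      apply hT.2
      rw [Set.mem_ofPred_eq, hc, hcomp₁, hcomp₂]
      have h1 := one_add_dualRank_lt he hle hs2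
      have h2 : dualRank e s₁ s₁ = 1 := by
        rw [dualRank_of_le le_rfl, Nat.sub_self, formsRank_zero]
      omega
    have hb : IsLeast {i | hQuot I₁ i + hQuot I₂ i < formsRank e i} t := by
      have : {i | hQuot (I₁ ⊓ I₂) i < formsRank e i} =
          {i | hQuot I₁ i + hQuot I₂ i < formsRank e i} := by
        ext i
        rw [Set.mem_ofPred_eq, Set.mem_ofPred_eq, hc, min_lt_iff]
        exact or_iff_right (lt_irrefl _)
      rwa [this] at hT
    refine ⟨⟨h2t, h12, h2t', hts, by omega, by omega⟩, hc, hb, ?_, hsoc, ?_, ?_⟩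
    · intro i hi
      simp only [hcomp₁, hcomp₂] at hb hi
      exact eq_add_one_of_formsRank_eq he hle hs2 hb hi
    · have h1 : I₂ ≤ maxIdeal k e ^ t₂ := by
        obtain ⟨m, rfl⟩ := Nat.exists_eq_add_of_le' (show 1 ≤ t₂ by omega)
        rw [le_maxIdeal_pow_succ_iff hI₂]
        intro i hi
        by_contra h
        have := hT₂.2 (not_le.1 h)
        omega
      have h2 : maxIdeal k e ^ (s₁ - t₂ + 1) * I₂ ≤ maxIdeal k e ^ (s₁ + 1) := by
        refine (Ideal.mul_mono_right h1).trans ?_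
        rw [← pow_add]
        exact Ideal.pow_le_pow_right (by omega)
      exact h2.trans ((socleDegree_le_iff hN₁).1 hs₁.ge)
    · intro n hn
      by_contra hlt'
      have h1 := gradedPiece_le_of_pow_mul_le (d := t₂) hI₁ hne₁ hN₁ hgor₁ (by omega) hn
      have h2 := hQuot_add_finrank hI t₂
      have h3 := hQuot_add_finrank hI₂ t₂
      -- In degree `t₂` the ideals `I` and `I₂` now agree, whereas (a) makes `h_R(t₂)` exceed
      -- `h_{R₂}(t₂) < h_Q(t₂)`, since `h_{R₁}(t₂) > 0`.
      rw [gradedPiece_inf, inf_eq_right.2 h1, hc] at h2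
      have h4 := hT₂.1
      rw [Set.mem_ofPred_eq] at h4
      have h5 : 0 < hQuot I₁ t₂ := by
        rw [hcomp₁]
        exact lt_min (formsRank_pos he _) (dualRank_pos he (by omega))
      omega
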